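/- All spaces are real. An equivalent norm on a Banach space $X$ is a norm $N$ with $c\|x\|\le N(x)\le C\|x\|$ for all $x\in X$ and some $c,C>0$; its dual norm on $X^*$ is $N^*(f)=\sup\{|f(x)|: N(x)\le 1\}$. A point $x$ with $N(x)=1$ is a *super Daugavet point* of $(X,N)$ if $\sup_{y\in V}N(x-y)=2$ for every non-empty relatively weakly open subset $V$ of the closed unit ball of $(X,N)$. If $E$ is a subspace of $X^*$, then $f\in E$ with $N^*(f)=1$ is a *weak$^*$ super Daugavet point* of $(E,N)$ if $\sup_{g\in V}N^*(f-g)=2$ for every non-empty subset $V$ of $B_{(E,N)}=\{g\in E: N^*(g)\le 1\}$ that is relatively open for the topology $\sigma(X^*,X)$. **Theorem.** Let $(X,\|\cdot\|)$ be an (infinite dimensional) Banach space with an unconditional, weakly null Schauder basis $(e_n)_{n\ge1}$ with $\inf_n\|e_n\|>0$, and let $(e_n^*)$ be its biorthogonal functionals. (a) There is an equivalent norm $q$ on $X$ for which $(e_n)$ is normalized ($q(e_n)=1$ for all $n$) and $1$-unconditional, i.e. $q(\sum a_ne_n)\le q(\sum b_ne_n)$ for all finitely supported real sequences with $|a_n|\le|b_n|$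 for all $n$. (b) Let $q$ be any equivalent norm as in (a), and let $A$ be the set of all finite sums $\sum_{n\ge2}a_ne_n$ with all $a_n\ge0$. Then there is an equivalent norm $N$ on $X$ whose closed unit ball is $$\overline{\mathrm{conv}}\{\pm(e_1+2x): x\in A,\ q(x)\le 1\},$$ and for this norm $e_1$ is a super Daugavet point of $(X,N)$, and $e_1^*$ is a weak$^*$ super Daugavet point of $(E,N)$, where $E=\overline{\mathrm{span}}\{e_n^*\}\subseteq X^*$. In particular, let $(e_n)$ be the unit vector basis of $\ell_2$. Then there is an equivalent norm $N$ on $\ell_2$, whose closed unit ball is the set in (b) with $q=\|\cdot\|_2$, such that $e_1$ is a super Daugavet point of $(\ell_2,N)$ and the functional $\langle e_1,\cdot\rangle$ is a super Daugavet point of $(\ell_2^*,N^*)$. -/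

import Mathlib

open Filter Topology

noncomputable section

namespace SuperDaugavet

variable {X : Type*} [NormedAddCommGroup X] [NormedSpace ℝ X]

/-- `N` is an equivalent norm on the real normed space `X`. -/
def IsEquivalentNorm (N : Seminorm ℝ X) : Prop :=
  ∃ c C : ℝ, 0 < c ∧ ∀ x, c * ‖x‖ ≤ N x ∧ N x ≤ C * ‖x‖

/-- The closed unit ball of a norm `N`. -/
def unitBall (N : X → ℝ) : Set X := {x | N x ≤ 1}

/-- The dual norm on `X*` of an equivalent norm `N` on `X`. -/
def dualNorm (N : X → ℝ) (f : StrongDual ℝ X) : ℝ :=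
  sSup ((fun x => |f x|) '' unitBall N)

/-- `x` is a super Daugavet point of `(X, N)`, for an equivalent norm `N` on `X`: `N x = 1` and
every non-empty relatively weakly open subset `V` of the unit ball of `N` satisfies
`sup {N (x - y) | y ∈ V} = 2`. (Equivalent norms have the same continuous functionals, hence the
same weak topology.) -/
def IsSuperDaugavetPoint (N : X → ℝ) (x : X) : Prop :=
  N x = 1 ∧ ∀ V : Set (WeakSpace ℝ X), IsOpen V →
    (toWeakSpace ℝ X ⁻¹' V ∩ unitBall N).Nonempty →
      IsLUB ((fun y => N (x - y)) '' (toWeakSpace ℝ X ⁻¹' V ∩ unitBall N)) 2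

/-- `f` is a weak* super Daugavet point of the subspace `E` of `X*`, where `X` carries the
equivalent norm `N`: the subspace `E` has the restriction of the dual norm of `N`, and its unit
ball the restriction of the topology `σ(X*, X)`. -/
def IsWeakStarSuperDaugavetPoint (N : X → ℝ) (E : Submodule ℝ (StrongDual ℝ X))
    (f : StrongDual ℝ X) : Prop :=
  f ∈ E ∧ dualNorm N f = 1 ∧ ∀ V : Set (WeakDual ℝ X), IsOpen V →
    (StrongDual.toWeakDual ⁻¹' V ∩ (E ∩ unitBall (dualNorm N))).Nonempty →
      IsLUB ((fun g => dualNorm N (f - g)) ''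
        (StrongDual.toWeakDual ⁻¹' V ∩ (E ∩ unitBall (dualNorm N)))) 2

/-- Every basis expansion converges unconditionally. -/
def IsUnconditional (e : SchauderBasis ℝ X) : Prop :=
  ∀ x, Summable fun n => e.coord n x • e n

/-- The sequence `e` converges weakly to `0`. -/
def IsWeaklyNull (e : ℕ → X) : Prop :=
  Tendsto (fun n => toWeakSpace ℝ X (e n)) atTop (𝓝 0)

/-- The sequence `e` is `1`-unconditional with respect to the norm `q`. -/
def IsOneUnconditional (q : X → ℝ) (e : ℕ → X) : Prop :=
  ∀ a b : ℕ →₀ ℝ, (∀ n, |a n| ≤ |b n|) →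
    q (Finsupp.linearCombination ℝ e a) ≤ q (Finsupp.linearCombination ℝ e b)

/-- The finitely supported elements with nonnegative coordinates of the closed span of all the
basis vectors but the first one (which is `e 0`). -/
def positiveTail (e : ℕ → X) : Set X :=
  {x | ∃ a : ℕ →₀ ℝ, a 0 = 0 ∧ (∀ n, 0 ≤ a n) ∧ x = Finsupp.linearCombination ℝ e a}

/-- The closed convex hull of the points `±(e 0 + 2 x)`, where `x` runs over the elements of
`positiveTail e` with `q x ≤ 1`. -/
def renormingBall (q : X → ℝ) (e : ℕ → X) : Set X :=
  closedConvexHull ℝ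
    {z | ∃ x ∈ positiveTail e ∩ unitBall q, z = e 0 + (2 : ℝ) • x ∨ z = -(e 0 + (2 : ℝ) • x)}

/-- The unit vector basis of `ℓ²`. -/
def unitVector (n : ℕ) : lp (fun _ : ℕ => ℝ) 2 := lp.single 2 n (1 : ℝ)

end SuperDaugavet

end

/-!
Let `B` be the renorming ball, the closed convex hull of the cap `K = {e 0 + 2 x}` and of `-K`, and
let `N` be its gauge. By `1`-unconditionality `B` contains every point of `q`-norm less than `1 / 3`
(split a finite combination into its first coordinate, its positive and its negative part), and
`q ≤ 3` on `B`, so `N` is an equivalent norm. A continuous functional is bounded by `1` on `B` as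
soon as it is so on `K`, and `e.coord 0` is constantly `1` on `K`.

*The point `e 0`* (`exists_smul_add_mem_renormingBall`). A weakly open set meeting `B` meets the
convex hull of `K ∪ -K`, in a point `y = s (e 0 + 2 x) - t (e 0 + 2 x')` with `s + t = 1`, where `x`
and `x'` may be given disjoint supports by cancelling their common part. For `n` large replace `x`
by `x + r e n`, where `r ∈ [0, 2]` is such that the `q`-norm becomes `1`. As the basis is weakly
null this moves `y` little in the weak topology. By `1`-unconditionality the new `x` is normed by a
positive functional `g` supported where it is (`exists_nonneg_norming_functional`). The functional
`f = e.coord 0 - g` takes on `K` the values `1 - 2 g x ∈ [-1, 1]`, so it is bounded by `1` on `B`;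
it is `1` at `e 0`, and at the moved `y` it is `s (-1) - t 1 = -1`, since `g x' = 0`. Hence the
distance of the two points is `2`.

*The functional `e.coord 0`* (`exists_sub_smul_coord`). Given `g` in the dual ball, subtract from it
the multiple `t • e.coord n` that makes its infimum over `K` equal to `-1`; here `0 ≤ t ≤ 1`. The
supremum over `K` does not increase, so the result `g'` is in the dual ball, and
`e.coord 0 - g' = 1 - g'` has supremum `2` over `K`. The change is small for `n` large in any vector
topology in which bounded multiples of `e.coord n` tend to `0`: the weak-star topology in general,
and the weak topology of the dual for the unit vector basis of `ℓ²`.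

*The norm `q`* is the supremum of `‖∑ n ∈ F, s n * x n • e n‖` over the finite sets `F` and the
weights with `|s n| ≤ 1 / ‖e n‖`. It is finite because the finite coordinate projections of an
unconditional basis are uniformly bounded.
-/

open Finsupp (linearCombination)

namespace SuperDaugavet

variable {X : Type*} [NormedAddCommGroup X] [NormedSpace ℝ X]

/-! ### Finite combinations of the basis and equivalent norms -/

theorem coord_linearCombination (e : SchauderBasis ℝ X) (a : ℕ →₀ ℝ) (n : ℕ) :
    e.coord n (linearCombination ℝ e.basis a) = a n := by
  classical
  rw [Finsupp.linearCombination_apply, Finsupp.sum, map_sum]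
  simp [e.ortho, Pi.single_apply, eq_comm]

theorem apply_linearCombination (f : StrongDual ℝ X) (u : ℕ → X) (a : ℕ →₀ ℝ) :
    f (linearCombination ℝ u a) = ∑ n ∈ a.support, a n * f (u n) := by
  simp [Finsupp.linearCombination_apply, Finsupp.sum]

/-- The finite linear combinations of a Schauder basis are dense. -/
theorem dense_range_linearCombination (e : SchauderBasis ℝ X) :
    DenseRange (linearCombination ℝ e.basis) := by
  intro x
  refine mem_closure_of_tendsto (SchauderBasis.tendsto_proj e x) (Eventually.of_forall fun n => ?_)
  rw [SchauderBasis.proj_apply]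
  refine ⟨∑ i ∈ Finset.range n, Finsupp.single i (e.coord i x), ?_⟩
  simp

namespace IsEquivalentNorm

theorem continuous {q : Seminorm ℝ X} (hq : IsEquivalentNorm q) : Continuous q := by
  obtain ⟨c, C, -, h⟩ := hq
  refine Seminorm.continuous_of_le (q := (Real.toNNReal C) • normSeminorm ℝ X) ?_ fun x => ?_
  · exact (continuous_norm (E := X)).const_smul (Real.toNNReal C)
  · refine (h x).2.trans ?_
    exact mul_le_mul_of_nonneg_right (Real.le_coe_toNNReal C) (norm_nonneg x)

end IsEquivalentNorm

/-! ### The generating cap of the renorming ball -/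

/-- The points `e 0 + 2 x`, where `x` runs over the elements of `positiveTail e` with `q x ≤ 1`:
the renorming ball is the closed convex hull of this set and of its reflection. -/
def cap (q : X → ℝ) (e : ℕ → X) : Set X :=
  {z | ∃ x ∈ positiveTail e ∩ unitBall q, z = e 0 + (2 : ℝ) • x}

theorem renormingBall_eq (q : X → ℝ) (e : ℕ → X) :
    renormingBall q e = closedConvexHull ℝ (cap q e ∪ -cap q e) := by
  unfold renormingBall
  congr 1
  ext z
  simp only [cap, Set.mem_union, Set.mem_neg, Set.mem_ofPred_eq]
  constructor
  · rintro ⟨x, hx, h | h⟩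
    exacts [Or.inl ⟨x, hx, h⟩, Or.inr ⟨x, hx, by rw [h, neg_neg]⟩]
  · rintro (⟨x, hx, h⟩ | ⟨x, hx, h⟩)
    exacts [⟨x, hx, Or.inl h⟩, ⟨x, hx, Or.inr (by rw [← h, neg_neg])⟩]

theorem convex_cap (q : Seminorm ℝ X) (e : ℕ → X) : Convex ℝ (cap q e) := by
  rintro _ ⟨_, ⟨⟨a, ha0, ha, rfl⟩, hqa⟩, rfl⟩ _ ⟨_, ⟨⟨b, hb0, hb, rfl⟩, hqb⟩, rfl⟩ s t hs ht hst
  refine ⟨_, ⟨⟨s • a + t • b, by simp [ha0, hb0], fun n => ?_, rfl⟩, ?_⟩, ?_⟩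
  · have := mul_nonneg hs (ha n)
    have := mul_nonneg ht (hb n)
    simp only [Finsupp.add_apply, Finsupp.smul_apply, smul_eq_mul]
    linarith
  · have h1 : q (linearCombination ℝ e a) ≤ 1 := hqa
    have h2 : q (linearCombination ℝ e b) ≤ 1 := hqb
    simp only [unitBall, Set.mem_ofPred_eq, map_add, map_smul]
    refine (map_add_le_add q _ _).trans ?_
    rw [map_smul_eq_mul, map_smul_eq_mul, Real.norm_of_nonneg hs, Real.norm_of_nonneg ht]
    nlinarith
  · simp only [map_add, map_smul]
    have : e 0 = s • e 0 + t • e 0 := by rw [← add_smul, hst, one_smul]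
    nth_rw 3 [this]
    module

theorem head_mem_cap (q : Seminorm ℝ X) (e : ℕ → X) : e 0 ∈ cap q e :=
  ⟨0, ⟨⟨0, by simp⟩, by simp [unitBall]⟩, by simp⟩

theorem cap_subset_renormingBall (q : X → ℝ) (e : ℕ → X) : cap q e ⊆ renormingBall q e := by
  rw [renormingBall_eq]
  exact Set.subset_union_left.trans subset_closedConvexHull

theorem convex_renormingBall (q : X → ℝ) (e : ℕ → X) : Convex ℝ (renormingBall q e) :=
  convex_closedConvexHull

theorem isClosed_renormingBall (q : X → ℝ) (e : ℕ → X) : IsClosed (renormingBall q e) :=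
  isClosed_closedConvexHull

theorem renormingBall_subset {q : X → ℝ} {e : ℕ → X} {s : Set X} (hs : Convex ℝ s)
    (hc : IsClosed s) (hneg : ∀ x ∈ s, -x ∈ s) (h : cap q e ⊆ s) : renormingBall q e ⊆ s := by
  rw [renormingBall_eq]
  refine closedConvexHull_min (Set.union_subset h fun x hx => ?_) hs hc
  simpa using hneg _ (h hx)

theorem neg_mem_renormingBall {q : X → ℝ} {e : ℕ → X} {x : X} (hx : x ∈ renormingBall q e) :
    -x ∈ renormingBall q e := by
  have := renormingBall_subset (q := q) (e := e) (s := renormingBall q e ∩ -renormingBall q e)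
    ((convex_renormingBall q e).inter (convex_renormingBall q e).neg)
    ((isClosed_renormingBall q e).inter (isClosed_renormingBall q e).neg)
    (fun y hy => ⟨hy.2, by simpa using hy.1⟩)
    (fun y hy => ⟨cap_subset_renormingBall q e hy, ?_⟩)
  · exact (this hx).2
  · have h : (-y : X) ∈ cap q e ∪ -cap q e := Or.inr (by simpa using hy)
    rw [Set.mem_neg, renormingBall_eq]
    exact subset_closedConvexHull h

theorem seminorm_le_of_mem_renormingBall {q : X → ℝ} {e : ℕ → X} {p : Seminorm ℝ X}
    (hp : Continuous p) {r : ℝ} (h : ∀ z ∈ cap q e, p z ≤ r) {z : X} (hz : z ∈ renormingBall q e) :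
    p z ≤ r := by
  have := renormingBall_subset (q := q) (e := e) (s := {z | p z ≤ r}) ?_ ?_ ?_ h
  · exact this hz
  · simpa using p.convexOn.convex_le r
  · exact isClosed_le hp continuous_const
  · intro x hx
    simpa [map_neg_eq_map] using hx

theorem abs_le_of_mem_renormingBall {q : X → ℝ} {e : ℕ → X} {f : StrongDual ℝ X} {r : ℝ}
    (h : ∀ z ∈ cap q e, |f z| ≤ r) {z : X} (hz : z ∈ renormingBall q e) : |f z| ≤ r := by
  have := renormingBall_subset (q := q) (e := e) (s := f ⁻¹' Set.Icc (-r) r)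
    ((convex_Icc _ _).linear_preimage f.toLinearMap) (isClosed_Icc.preimage f.continuous)
    (fun x hx => by simpa [and_comm, neg_le] using hx) (fun x hx => abs_le.1 (h x hx))
  exact abs_le.2 (this hz)

theorem head_add_single_mem_cap {q : X → ℝ} {e : ℕ → X} (hq1 : ∀ n, q (e n) = 1) {n : ℕ}
    (hn : n ≠ 0) : e 0 + (2 : ℝ) • e n ∈ cap q e := by
  refine ⟨e n, ⟨⟨Finsupp.single n 1, by simp [hn.symm], fun m => ?_, by simp⟩, (hq1 n).le⟩, rfl⟩
  exact (Finsupp.single_nonneg.2 zero_le_one : (0 : ℕ →₀ ℝ) ≤ _) m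

/-! ### The renorming -/

theorem coord_le_of_isOneUnconditional {q : Seminorm ℝ X} {e : ℕ → X} (hq1 : ∀ n, q (e n) = 1)
    (hu : IsOneUnconditional q e) (a : ℕ →₀ ℝ) (n : ℕ) : |a n| ≤ q (linearCombination ℝ e a) := by
  have := hu (Finsupp.single n (a n)) a fun m => by
    rcases eq_or_ne m n with rfl | h
    · simp
    · simp [Finsupp.single_eq_of_ne h]
  simpa [map_smul_eq_mul, hq1] using this

/-- The part of the combination after the first coordinate is split into its positive and its
negative part; suitably scaled, each of these is half the difference of two points of the cap. -/
theorem linearCombination_mem_renormingBall {q : Seminorm ℝ X} {e : ℕ → X}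
    (hq1 : ∀ n, q (e n) = 1) (hu : IsOneUnconditional q e) {a : ℕ →₀ ℝ}
    (ha : 3 * q (linearCombination ℝ e a) ≤ 1) :
    linearCombination ℝ e a ∈ renormingBall q e := by
  have hpart : ∀ b : ℕ →₀ ℝ, b 0 = 0 → (∀ n, 0 ≤ b n) → (∀ n, |b n| ≤ |((3 : ℝ) • a) n|) →
      linearCombination ℝ e b ∈ renormingBall q e := by
    intro b hb0 hb hba
    have hqb : q (linearCombination ℝ e b) ≤ 1 := by
      refine (hu b _ hba).trans ?_
      rw [map_smul, map_smul_eq_mul]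
      simpa using ha
    have h1 := cap_subset_renormingBall q e ⟨_, ⟨⟨b, hb0, hb, rfl⟩, hqb⟩, rfl⟩
    have h2 := neg_mem_renormingBall (cap_subset_renormingBall q e (head_mem_cap q e))
    have := convex_renormingBall q e h1 h2 (a := 1 / 2) (b := 1 / 2) (by norm_num) (by norm_num)
      (by norm_num)
    convert this using 1
    module
  set u : ℕ →₀ ℝ := ((3 : ℝ) • a.erase 0).mapRange (fun t => max t 0) (by simp) with hu'
  set v : ℕ →₀ ℝ := ((3 : ℝ) • a.erase 0).mapRange (fun t => max (-t) 0) (by simp) with hv'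
  have hau : ∀ n, (3 : ℝ) * a.erase 0 n = u n - v n := fun n => by
    simp only [hu', hv', Finsupp.mapRange_apply, Finsupp.smul_apply, smul_eq_mul]
    rcases le_total 0 (3 * a.erase 0 n) with h | h
    · rw [max_eq_left h, max_eq_right (by linarith), sub_zero]
    · rw [max_eq_right h, max_eq_left (by linarith)]; ring
  have habs : ∀ n, |a.erase 0 n| ≤ |a n| := fun n => by
    rcases eq_or_ne n 0 with rfl | h
    · simp
    · rw [Finsupp.erase_ne h]
  have hU := hpart u (by simp [hu']) (fun n => by simp [hu']) fun n => by
    have := habs n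
    simp only [hu', Finsupp.mapRange_apply, Finsupp.smul_apply, smul_eq_mul]
    rw [abs_of_nonneg (le_max_right _ _), abs_mul, abs_of_pos (three_pos (α := ℝ))]
    exact max_le (by nlinarith [le_abs_self (a.erase 0 n)]) (by positivity)
  have hV := hpart v (by simp [hv']) (fun n => by simp [hv']) fun n => by
    have := habs n
    simp only [hv', Finsupp.mapRange_apply, Finsupp.smul_apply, smul_eq_mul]
    rw [abs_of_nonneg (le_max_right _ _), abs_mul, abs_of_pos (three_pos (α := ℝ))]
    exact max_le (by nlinarith [neg_le_abs (a.erase 0 n)]) (by positivity)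
  have hE : (3 * a 0) • e 0 ∈ renormingBall q e := by
    have h0 := cap_subset_renormingBall q e (head_mem_cap q e)
    have hbal := (balanced_iff_neg_mem (convex_renormingBall q e)).2
      (fun x => neg_mem_renormingBall)
    refine hbal.smul_mem ?_ h0
    have := coord_le_of_isOneUnconditional hq1 hu a 0
    rw [Real.norm_eq_abs, abs_mul, abs_of_pos (three_pos (α := ℝ))]
    linarith
  have hW := convex_renormingBall q e hU (neg_mem_renormingBall hV)
    (a := 1 / 2) (b := 1 / 2) (by norm_num) (by norm_num) (by norm_num)
  have := convex_renormingBall q e hE hW (a := 1 / 3) (b := 2 / 3) (by norm_num) (by norm_num)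
    (by norm_num)
  convert this using 1
  have hsplit : a = Finsupp.single 0 (a 0) + (1 / 3 : ℝ) • (u - v) := by
    ext n
    have := hau n
    rcases eq_or_ne n 0 with rfl | h
    · have h0 : u 0 - v 0 = 0 := by rw [← this]; simp
      simp [h0]
    · rw [Finsupp.erase_ne h] at this
      simp [Finsupp.single_eq_of_ne h, ← this]
  nth_rw 1 [hsplit]
  simp only [map_add, map_sub, map_smul, Finsupp.linearCombination_single]
  module

theorem mem_renormingBall_of_le {e : SchauderBasis ℝ X} {q : Seminorm ℝ X}
    (hq : IsEquivalentNorm q) (hq1 : ∀ n, q (e n) = 1) (hu : IsOneUnconditional q e.basis)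
    {x : X} (hx : q x < 1 / 3) : x ∈ renormingBall q e.basis := by
  have hop : IsOpen {x | q x < 1 / 3} := isOpen_lt hq.continuous continuous_const
  have := (dense_range_linearCombination e).open_subset_closure_inter hop hx
  refine closure_minimal ?_ (isClosed_renormingBall q e.basis) this
  rintro _ ⟨hy, a, rfl⟩
  refine linearCombination_mem_renormingBall hq1 hu ?_
  have : q (linearCombination ℝ e.basis a) < 1 / 3 := hy
  linarith

theorem le_three_of_mem_renormingBall {e : ℕ → X} {q : Seminorm ℝ X}
    (hq : IsEquivalentNorm q) (hq1 : ∀ n, q (e n) = 1)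
    {x : X} (hx : x ∈ renormingBall q e) : q x ≤ 3 := by
  refine seminorm_le_of_mem_renormingBall hq.continuous ?_ hx
  rintro _ ⟨y, ⟨-, hy⟩, rfl⟩
  have hy : q y ≤ 1 := hy
  refine (map_add_le_add q _ _).trans ?_
  rw [map_smul_eq_mul, hq1]
  norm_num
  linarith

/-- The renorming ball is the unit ball of an equivalent norm, its gauge. -/
theorem exists_norm_unitBall_eq_renormingBall {e : SchauderBasis ℝ X} {q : Seminorm ℝ X}
    (hq : IsEquivalentNorm q) (hq1 : ∀ n, q (e n) = 1) (hu : IsOneUnconditional q e.basis) :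
    ∃ N : Seminorm ℝ X, IsEquivalentNorm N ∧ unitBall N = renormingBall q e.basis := by
  have hnhds : renormingBall q e.basis ∈ 𝓝 (0 : X) := by
    refine mem_of_superset ((isOpen_lt hq.continuous continuous_const).mem_nhds ?_)
      (fun x (hx : q x < 1 / 3) => mem_renormingBall_of_le hq hq1 hu hx)
    simp
  have hconv := convex_renormingBall q e.basis
  let N : Seminorm ℝ X := gaugeSeminorm ((balanced_iff_neg_mem hconv).2
    (fun x => neg_mem_renormingBall)) hconv (absorbent_nhds_zero hnhds)
  have hN : unitBall N = renormingBall q e.basis := by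
    ext x
    change gauge _ x ≤ 1 ↔ _
    rw [gauge_le_one_iff_mem_closure hconv hnhds, (isClosed_renormingBall q e.basis).closure_eq]
  refine ⟨N, ?_, hN⟩
  obtain ⟨c, C, hc, h⟩ := hq
  have hsub : renormingBall q e.basis ⊆ Metric.closedBall 0 (3 / c) := fun x hx => by
    rw [mem_closedBall_zero_iff, le_div_iff₀ hc, mul_comm]
    exact (h x).1.trans (le_three_of_mem_renormingBall ⟨c, C, hc, h⟩ hq1 hx)
  obtain ⟨r, hr, hball⟩ := Metric.mem_nhds_iff.1 hnhds
  refine ⟨c / 3, r⁻¹, by positivity, fun x => ⟨?_, ?_⟩⟩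
  · have := le_gauge_of_subset_closedBall (absorbent_nhds_zero hnhds) (by positivity) hsub (x := x)
    change _ ≤ gauge _ x
    refine le_trans (le_of_eq ?_) this
    field_simp
  · have := mul_gauge_le_norm hball (x := x)
    change gauge _ x ≤ _
    rwa [inv_mul_eq_div, le_div_iff₀ hr, mul_comm]

/-! ### Weak limits of bounded multiples -/

theorem isWeaklyNull_iff {u : ℕ → X} :
    IsWeaklyNull u ↔ ∀ f : StrongDual ℝ X, Tendsto (fun n => f (u n)) atTop (𝓝 0) := by
  have hinj : Function.Injective (topDualPairing ℝ X).flip := by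
    intro x y h
    rw [SeparatingDual.eq_iff_forall_dual_eq (R := ℝ)]
    exact fun f => DFunLike.congr_fun h f
  refine (WeakBilin.tendsto_iff_forall_eval_tendsto _ hinj).trans (forall_congr' fun f => ?_)
  change Tendsto (fun n => f (u n)) atTop (𝓝 (f 0)) ↔ _
  rw [map_zero]

theorem tendsto_mul_of_mem_Icc {s : ℕ → ℝ} {r : ℝ} (hs : ∀ n, s n ∈ Set.Icc 0 r) {t : ℕ → ℝ}
    (ht : Tendsto t atTop (𝓝 0)) : Tendsto (fun n => s n * t n) atTop (𝓝 0) := by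
  refine bdd_le_mul_tendsto_zero' r (Eventually.of_forall fun n => ?_) ht
  rw [abs_of_nonneg (hs n).1]
  exact (hs n).2

theorem IsWeaklyNull.tendsto_add_smul {u : ℕ → X} (hu : IsWeaklyNull u) {s : ℕ → ℝ} {r : ℝ}
    (hs : ∀ n, s n ∈ Set.Icc 0 r) (x : X) :
    Tendsto (fun n => toWeakSpace ℝ X (x + s n • u n)) atTop (𝓝 (toWeakSpace ℝ X x)) := by
  have h : IsWeaklyNull fun n => s n • u n := by
    rw [isWeaklyNull_iff] at hu ⊢
    intro f
    simpa using tendsto_mul_of_mem_Icc hs (hu f)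
  have := (tendsto_const_nhds (x := toWeakSpace ℝ X x)).add h
  simpa using this

/-! ### The first basis vector is a super Daugavet point -/

theorem exists_le_seminorm_eq (q : Seminorm ℝ X) (x : X) :
    ∃ h : Module.Dual ℝ X, h x = q x ∧ ∀ y, h y ≤ q y := by
  rcases eq_or_ne x 0 with rfl | hx
  · exact ⟨0, by simp, fun y => by simp⟩
  let φ := (LinearEquiv.toSpanNonzeroSingleton ℝ X x hx).symm
  have hφ : ∀ (t : ℝ) (ht : t • x ∈ Submodule.span ℝ {x}), φ ⟨t • x, ht⟩ = t := fun t ht => by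
    rw [LinearEquiv.symm_apply_eq]; rfl
  have hp : ∀ y : Submodule.span ℝ {x}, (q x • φ.toLinearMap) y ≤ q y := by
    rintro ⟨y, hy⟩
    obtain ⟨t, rfl⟩ := Submodule.mem_span_singleton.1 hy
    simp only [LinearMap.smul_apply, LinearEquiv.coe_coe, hφ, smul_eq_mul, map_smul_eq_mul]
    rw [mul_comm]
    exact mul_le_mul_of_nonneg_right (le_abs_self t) (apply_nonneg q x)
  obtain ⟨h, h1, h2⟩ := Module.Dual.exists_extension_of_le_seminorm_real _ _ hp
  refine ⟨h, ?_, fun y => (le_abs_self _).trans (h2 y)⟩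
  have := h1 ⟨(1 : ℝ) • x, Submodule.smul_mem _ _ (Submodule.mem_span_singleton_self x)⟩
  rw [LinearMap.smul_apply, LinearEquiv.coe_coe, hφ] at this
  simpa using this

/-- A nonnegative finite combination `x` of a 1-unconditional basis is normed by a functional which
is positive, dominated by the norm on nonnegative combinations, and supported where `x` is: it
suffices to drop the negative coefficients, and those off the support, of any norming functional. -/
theorem exists_nonneg_norming_functional (e : SchauderBasis ℝ X) {q : Seminorm ℝ X}
    (hu : IsOneUnconditional q e.basis) {a : ℕ →₀ ℝ} (ha : ∀ n, 0 ≤ a n) :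
    ∃ g : StrongDual ℝ X,
      (∀ b : ℕ →₀ ℝ, (∀ n, 0 ≤ b n) → 0 ≤ g (linearCombination ℝ e.basis b) ∧
        g (linearCombination ℝ e.basis b) ≤ q (linearCombination ℝ e.basis b)) ∧
      g (linearCombination ℝ e.basis a) = q (linearCombination ℝ e.basis a) ∧
      ∀ n, a n = 0 → g (e n) = 0 := by
  obtain ⟨h, hx, hle⟩ := exists_le_seminorm_eq q (linearCombination ℝ e.basis a)
  let g : StrongDual ℝ X := ∑ n ∈ a.support, max (h (e n)) 0 • e.coord n
  have hg : ∀ b : ℕ →₀ ℝ, g (linearCombination ℝ e.basis b) =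
      ∑ n ∈ a.support, max (h (e n)) 0 * b n := fun b => by
    simp [g, coord_linearCombination]
  have hbound : ∀ b : ℕ →₀ ℝ, (∀ n, 0 ≤ b n) → 0 ≤ g (linearCombination ℝ e.basis b) ∧
      g (linearCombination ℝ e.basis b) ≤ q (linearCombination ℝ e.basis b) := by
    intro b hb
    rw [hg]
    refine ⟨Finset.sum_nonneg fun n _ => mul_nonneg (le_max_right _ _) (hb n), ?_⟩
    classical
    let b' : ℕ →₀ ℝ := ∑ n ∈ a.support with 0 ≤ h (e n), Finsupp.single n (b n)
    have hb' : ∀ n, b' n = if n ∈ a.support ∧ 0 ≤ h (e n) then b n else 0 := fun n => by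
      simp only [b', Finsupp.finsetSum_apply, Finsupp.single_apply, Finset.sum_ite_eq',
        Finset.mem_filter]
    have hval : h (linearCombination ℝ e.basis b') =
        ∑ n ∈ a.support, max (h (e n)) 0 * b n := by
      rw [Finset.sum_congr rfl fun n _ => show max (h (e n)) 0 * b n =
        if 0 ≤ h (e n) then b n * h (e n) else 0 by
          split_ifs with h0
          · rw [max_eq_left h0, mul_comm]
          · rw [max_eq_right (le_of_not_ge h0), zero_mul], ← Finset.sum_filter]
      simp [b']
    rw [← hval]
    refine (hle _).trans (hu _ _ fun n => ?_)
    rw [hb']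
    split_ifs <;> simp
  refine ⟨g, hbound, le_antisymm (hbound a ha).2 ?_, fun n hn => ?_⟩
  · rw [← hx, hg, Finsupp.linearCombination_apply, Finsupp.sum, map_sum]
    refine Finset.sum_le_sum fun n _ => ?_
    rw [map_smul, smul_eq_mul, mul_comm]
    exact mul_le_mul_of_nonneg_right (le_max_left _ _) (ha n)
  · have := hg (Finsupp.single n 1)
    simp only [Finsupp.linearCombination_single, one_smul] at this
    rw [this]
    refine Finset.sum_eq_zero fun m hm => ?_
    have : m ≠ n := by
      rintro rfl
      exact (Finsupp.mem_support_iff.1 hm) hn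
    simp [Finsupp.single_eq_of_ne this]

/-- Along any basis direction a point of the unit ball can be moved to the unit sphere. -/
theorem exists_add_single_norm_eq_one {e : ℕ → X} {q : Seminorm ℝ X} (hq : IsEquivalentNorm q)
    (hq1 : ∀ n, q (e n) = 1) {x : X} (hx : q x ≤ 1) (n : ℕ) :
    ∃ s ∈ Set.Icc (0 : ℝ) 2, q (x + s • e n) = 1 := by
  have hc : ContinuousOn (fun s : ℝ => q (x + s • e n)) (Set.Icc 0 2) := by
    have := hq.continuous
    fun_prop
  refine intermediate_value_Icc zero_le_two hc ⟨by simpa using hx, ?_⟩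
  have h1 := map_sub_le_add q (x + (2 : ℝ) • e n) x
  rw [add_sub_cancel_left, map_smul_eq_mul, hq1] at h1
  norm_num at h1
  linarith

/-- A convex combination of a point of the cap and of a reflected one can be rewritten so that the
two points have disjoint supports: their common part cancels. -/
theorem exists_disjoint_of_mem_convexHull {e : ℕ → X} {q : Seminorm ℝ X}
    (hu : IsOneUnconditional q e) {y : X} (hy : y ∈ convexHull ℝ (cap q e ∪ -cap q e)) :
    ∃ s t : ℝ, 0 ≤ s ∧ 0 ≤ t ∧ s + t = 1 ∧ ∃ a b : ℕ →₀ ℝ, a 0 = 0 ∧ b 0 = 0 ∧ (∀ n, 0 ≤ a n) ∧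
      (∀ n, 0 ≤ b n) ∧ q (linearCombination ℝ e a) ≤ 1 ∧ q (linearCombination ℝ e b) ≤ 1 ∧
      (∀ n, a n = 0 ∨ b n = 0) ∧
      y = s • (e 0 + (2 : ℝ) • linearCombination ℝ e a) -
        t • (e 0 + (2 : ℝ) • linearCombination ℝ e b) := by
  rw [(convex_cap q e).convexHull_union (convex_cap q e).neg ⟨_, head_mem_cap q e⟩
    ⟨-e 0, by simpa using head_mem_cap q e⟩, mem_convexJoin] at hy
  obtain ⟨_, ⟨_, ⟨⟨a, ha0, ha, rfl⟩, hqa⟩, rfl⟩, z, ⟨_, ⟨⟨b, hb0, hb, rfl⟩, hqb⟩, hz⟩,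
    s, t, hs, ht, hst, rfl⟩ := hy
  have hz : z = -(e 0 + (2 : ℝ) • linearCombination ℝ e b) := by rw [← hz, neg_neg]
  have hqa : q (linearCombination ℝ e a) ≤ 1 := hqa
  have hqb : q (linearCombination ℝ e b) ≤ 1 := hqb
  let u : ℕ →₀ ℝ := (s • a - t • b).mapRange (fun r => max r 0) (by simp)
  let v : ℕ →₀ ℝ := (s • a - t • b).mapRange (fun r => max (-r) 0) (by simp)
  have hun : ∀ n, u n = max (s * a n - t * b n) 0 := fun n => by simp [u]
  have hvn : ∀ n, v n = max (t * b n - s * a n) 0 := fun n => by simp [v]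
  have hsa : ∀ n, 0 ≤ s * a n := fun n => mul_nonneg hs (ha n)
  have htb : ∀ n, 0 ≤ t * b n := fun n => mul_nonneg ht (hb n)
  have hu_le : ∀ n, u n ≤ s * a n := fun n => by
    rw [hun]; exact max_le (by linarith [htb n]) (hsa n)
  have hv_le : ∀ n, v n ≤ t * b n := fun n => by
    rw [hvn]; exact max_le (by linarith [hsa n]) (htb n)
  have hu0 : ∀ n, 0 ≤ u n := fun n => by rw [hun]; exact le_max_right _ _
  have hv0 : ∀ n, 0 ≤ v n := fun n => by rw [hvn]; exact le_max_right _ _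
  -- If a weight vanishes, so does the vector divided by it, and `0⁻¹ = 0` does no harm.
  have scale : ∀ (r : ℝ) (w c : ℕ →₀ ℝ), 0 ≤ r → (∀ n, 0 ≤ w n) → (∀ n, 0 ≤ c n) →
      (∀ n, w n ≤ r * c n) → r • (r⁻¹ • w) = w ∧ (∀ n, (r⁻¹ • w) n ≤ c n) := by
    intro r w c hr hw hc hwc
    rcases hr.eq_or_lt with rfl | hr
    · have : w = 0 := by
        ext n
        exact le_antisymm (by simpa using hwc n) (hw n)
      simp [this, hc]
    · refine ⟨smul_inv_smul₀ hr.ne' w, fun n => ?_⟩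
      rw [Finsupp.smul_apply, smul_eq_mul, inv_mul_le_iff₀ hr]
      exact hwc n
  obtain ⟨hsu, hua⟩ := scale s u a hs hu0 ha hu_le
  obtain ⟨htv, hvb⟩ := scale t v b ht hv0 hb hv_le
  have hua0 : ∀ n, 0 ≤ (s⁻¹ • u) n := fun n => mul_nonneg (inv_nonneg.2 hs) (hu0 n)
  have hvb0 : ∀ n, 0 ≤ (t⁻¹ • v) n := fun n => mul_nonneg (inv_nonneg.2 ht) (hv0 n)
  refine ⟨s, t, hs, ht, hst, s⁻¹ • u, t⁻¹ • v, ?_, ?_, hua0, hvb0, ?_, ?_, fun n => ?_, ?_⟩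
  · simp [hun, ha0, hb0]
  · simp [hvn, ha0, hb0]
  · refine (hu _ a fun n => ?_).trans hqa
    rw [abs_of_nonneg (hua0 n), abs_of_nonneg (ha n)]
    exact hua n
  · refine (hu _ b fun n => ?_).trans hqb
    rw [abs_of_nonneg (hvb0 n), abs_of_nonneg (hb n)]
    exact hvb n
  · rcases le_total (s * a n) (t * b n) with h | h
    · left; simp [hun, h]
    · right; simp [hvn, h]
  · have huv : u - v = s • a - t • b := by
      ext n
      simp only [Finsupp.sub_apply, hun, hvn, Finsupp.smul_apply, smul_eq_mul]
      rcases le_total (s * a n) (t * b n) with h | h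
      · rw [max_eq_right (by linarith), max_eq_left (by linarith)]; ring
      · rw [max_eq_left (by linarith), max_eq_right (by linarith)]; ring
    have h1 := congrArg (linearCombination ℝ e) huv
    have h2 := congrArg (linearCombination ℝ e) hsu
    have h3 := congrArg (linearCombination ℝ e) htv
    simp only [map_sub, map_smul] at h1 h2 h3 ⊢
    rw [hz]
    linear_combination (norm := module) (2 : ℝ) • h3 - (2 : ℝ) • h2 - (2 : ℝ) • h1

/-- Every point of the convex hull is moved by `r • e n`, with `0 ≤ r ≤ 4` and `n` large, to a point
of the renorming ball at distance `2` from `e 0`. -/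
theorem exists_smul_add_mem_renormingBall (e : SchauderBasis ℝ X) {q : Seminorm ℝ X}
    (hq : IsEquivalentNorm q) (hq1 : ∀ n, q (e n) = 1) (hu : IsOneUnconditional q e.basis)
    {y : X} (hy : y ∈ convexHull ℝ (cap q e.basis ∪ -cap q e.basis)) :
    ∃ m : ℕ, ∀ n ≥ m, ∃ r ∈ Set.Icc (0 : ℝ) 4, y + r • e n ∈ renormingBall q e.basis ∧
      ∃ f : StrongDual ℝ X, (∀ z ∈ renormingBall q e.basis, |f z| ≤ 1) ∧
        f (e 0 - (y + r • e n)) = 2 := by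
  obtain ⟨s, t, hs, ht, hst, a, b, ha0, hb0, ha, hb, hqa, hqb, hab, rfl⟩ :=
    exists_disjoint_of_mem_convexHull hu hy
  obtain ⟨m, hm⟩ := b.support.exists_nat_subset_range
  refine ⟨m + 1, fun n hn => ?_⟩
  have hn0 : n ≠ 0 := by omega
  have hbn : b n = 0 := by
    by_contra h
    have := Finset.mem_range.1 (hm (Finsupp.mem_support_iff.2 h))
    omega
  obtain ⟨r, hr, hr1⟩ := exists_add_single_norm_eq_one hq hq1 hqa n
  set a' : ℕ →₀ ℝ := a + Finsupp.single n r with ha'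
  have hLa' : linearCombination ℝ e.basis a' = linearCombination ℝ e.basis a + r • e n := by
    simp [ha']
  have ha'0 : ∀ k, 0 ≤ a' k := fun k =>
    add_nonneg (ha k) ((Finsupp.single_nonneg.2 hr.1 : (0 : ℕ →₀ ℝ) ≤ _) k)
  have ha'z : a' 0 = 0 := by simp [ha', ha0, hn0.symm]
  rw [← hLa'] at hr1
  obtain ⟨g, hg, hga, hgs⟩ := exists_nonneg_norming_functional e hu ha'0
  rw [hr1] at hga
  have hgb : g (linearCombination ℝ e.basis b) = 0 := by
    rw [apply_linearCombination]
    refine Finset.sum_eq_zero fun k hk => ?_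
    have hbk := Finsupp.mem_support_iff.1 hk
    have hkn : k ≠ n := by
      rintro rfl
      exact hbk hbn
    rw [hgs k, mul_zero]
    simp [ha', Finsupp.single_eq_of_ne hkn, (hab k).resolve_right hbk]
  have hpa : e 0 + (2 : ℝ) • linearCombination ℝ e.basis a' ∈ cap q e.basis :=
    ⟨_, ⟨⟨a', ha'z, ha'0, rfl⟩, hr1.le⟩, rfl⟩
  have hpb : e 0 + (2 : ℝ) • linearCombination ℝ e.basis b ∈ cap q e.basis :=
    ⟨_, ⟨⟨b, hb0, hb, rfl⟩, hqb⟩, rfl⟩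
  have heq : s • (e 0 + (2 : ℝ) • linearCombination ℝ e.basis a) -
      t • (e 0 + (2 : ℝ) • linearCombination ℝ e.basis b) + (2 * s * r) • e n =
      s • (e 0 + (2 : ℝ) • linearCombination ℝ e.basis a') +
        t • -(e 0 + (2 : ℝ) • linearCombination ℝ e.basis b) := by
    rw [hLa']
    module
  have he0 : e.coord 0 (e 0) = 1 := by simp [e.ortho]
  have hc : ∀ c : ℕ →₀ ℝ, (e.coord 0 - g) (e 0 + (2 : ℝ) • linearCombination ℝ e.basis c) =
      1 + 2 * c 0 - 2 * g (linearCombination ℝ e.basis c) := fun c => by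
    have := hgs 0 ha'z
    simp only [sub_apply, map_add, map_smul, smul_eq_mul, he0,
      coord_linearCombination, this]
    ring
  refine ⟨2 * s * r, ⟨by have := hr.1; positivity, ?_⟩, ?_, e.coord 0 - g, fun z hz => ?_, ?_⟩
  · nlinarith [hr.1, hr.2]
  · rw [heq]
    exact convex_renormingBall q e.basis (cap_subset_renormingBall _ _ hpa)
      (neg_mem_renormingBall (cap_subset_renormingBall _ _ hpb)) hs ht hst
  · refine abs_le_of_mem_renormingBall ?_ hz
    rintro _ ⟨_, ⟨⟨c, hc0, hcn, rfl⟩, hqc⟩, rfl⟩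
    have hqc : q (linearCombination ℝ e.basis c) ≤ 1 := hqc
    rw [hc, hc0, abs_le]
    have := hg c hcn
    constructor <;> linarith [this.1, this.2]
  · rw [heq, map_sub, map_add, map_smul, map_smul, map_neg, hc, hc, hga, hgb, ha'z, hb0]
    have := hgs 0 ha'z
    simp only [sub_apply, he0, this, smul_eq_mul]
    linarith

theorem abs_apply_le_of_unitBall {N : Seminorm ℝ X} (hN : IsEquivalentNorm N)
    {f : StrongDual ℝ X} {r : ℝ} (hf : ∀ z ∈ unitBall N, |f z| ≤ r) (x : X) :
    |f x| ≤ r * N x := by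
  obtain ⟨c, C, hc, h⟩ := hN
  rcases eq_or_ne x 0 with rfl | hx
  · simp
  have hpos : 0 < N x := lt_of_lt_of_le (mul_pos hc (norm_pos_iff.2 hx)) (h x).1
  have := hf ((N x)⁻¹ • x) (by
    change N _ ≤ 1
    rw [map_smul_eq_mul, norm_inv, Real.norm_of_nonneg hpos.le, inv_mul_cancel₀ hpos.ne'])
  rwa [map_smul, smul_eq_mul, abs_mul, abs_inv, abs_of_pos hpos, inv_mul_le_iff₀ hpos,
    mul_comm] at this

theorem abs_coord_zero_le_one {q : X → ℝ} {e : SchauderBasis ℝ X} {z : X}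
    (hz : z ∈ renormingBall q e.basis) : |e.coord 0 z| ≤ 1 := by
  refine abs_le_of_mem_renormingBall ?_ hz
  rintro _ ⟨_, ⟨⟨a, ha, -, rfl⟩, -⟩, rfl⟩
  simp [coord_linearCombination, ha, e.ortho]

theorem isSuperDaugavetPoint_head {e : SchauderBasis ℝ X} {q : Seminorm ℝ X}
    (he : IsWeaklyNull e.basis) (hq : IsEquivalentNorm q) (hq1 : ∀ n, q (e n) = 1)
    (hu : IsOneUnconditional q e.basis) {N : Seminorm ℝ X} (hN : IsEquivalentNorm N)
    (hball : unitBall N = renormingBall q e.basis) : IsSuperDaugavetPoint N (e 0) := by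
  have hN0 : N (e 0) ≤ 1 := by
    change e 0 ∈ unitBall N
    rw [hball]
    exact cap_subset_renormingBall _ _ (head_mem_cap q e.basis)
  refine ⟨le_antisymm hN0 ?_, fun V hV hne => ⟨?_, fun u hu' => ?_⟩⟩
  · have := abs_apply_le_of_unitBall hN (f := e.coord 0) (r := 1)
      (fun z hz => abs_coord_zero_le_one (q := q) (hball ▸ hz)) (e 0)
    simpa [e.ortho] using this
  · rintro _ ⟨y, ⟨-, hy⟩, rfl⟩
    have hy : N y ≤ 1 := hy
    exact (map_sub_le_add N _ _).trans (by linarith)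
  · -- The point of `V` may be taken in the convex hull, since `V` is norm open.
    obtain ⟨y₀, hy₀V, hy₀⟩ := hne
    rw [hball, renormingBall_eq, closedConvexHull_eq_closure_convexHull] at hy₀
    have hVo : IsOpen (toWeakSpace ℝ X ⁻¹' V) := hV.preimage (toWeakSpaceCLM ℝ X).continuous
    obtain ⟨y, hyV, hy⟩ := mem_closure_iff.1 hy₀ _ hVo hy₀V
    obtain ⟨m, hm⟩ := exists_smul_add_mem_renormingBall e hq hq1 hu hy
    choose! r hr hrB f hf hf2 using hm
    let r' : ℕ → ℝ := fun n => if m ≤ n then r n else 0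
    have hr' : ∀ n, r' n ∈ Set.Icc (0 : ℝ) 4 := fun n => by
      by_cases h : m ≤ n
      · simpa only [r', if_pos h] using hr n h
      · simp [r', if_neg h]
    have hev := (he.tendsto_add_smul hr' y).eventually (hV.mem_nhds hyV)
    obtain ⟨n, hn, hmn⟩ := (hev.and (eventually_ge_atTop m)).exists
    have hrn : r' n = r n := if_pos hmn
    rw [hrn] at hn
    have h2 : 2 ≤ N (e 0 - (y + r n • e n)) := by
      have := abs_apply_le_of_unitBall hN (f := f n) (r := 1)
        (fun z hz => hf n hmn z (hball ▸ hz)) (e 0 - (y + r n • e n))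
      rw [hf2 n hmn, one_mul] at this
      simpa using this
    exact h2.trans (hu' ⟨_, ⟨hn, hball ▸ hrB n hmn⟩, rfl⟩)

/-! ### The first coordinate functional -/

theorem abs_apply_le_dualNorm {N : Seminorm ℝ X} (hN : IsEquivalentNorm N) (f : StrongDual ℝ X)
    {x : X} (hx : x ∈ unitBall N) : |f x| ≤ dualNorm N f := by
  obtain ⟨c, C, hc, h⟩ := hN
  refine le_csSup ⟨‖f‖ * c⁻¹, ?_⟩ ⟨x, hx, rfl⟩
  rintro _ ⟨y, hy, rfl⟩
  refine (f.le_opNorm y).trans (mul_le_mul_of_nonneg_left ?_ (norm_nonneg f))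
  have hy : N y ≤ 1 := hy
  rw [← one_div, le_div_iff₀ hc, mul_comm]
  exact (h y).1.trans hy

theorem dualNorm_le {N : Seminorm ℝ X} {f : StrongDual ℝ X} {r : ℝ}
    (h : ∀ x ∈ unitBall N, |f x| ≤ r) : dualNorm N f ≤ r := by
  refine csSup_le ⟨_, 0, by simp [unitBall], rfl⟩ ?_
  rintro _ ⟨y, hy, rfl⟩
  exact h y hy

theorem dualNorm_sub_le {N : Seminorm ℝ X} (hN : IsEquivalentNorm N) (f g : StrongDual ℝ X) :
    dualNorm N (f - g) ≤ dualNorm N f + dualNorm N g := by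
  refine dualNorm_le fun x hx => ?_
  rw [sub_apply]
  exact (abs_sub _ _).trans
    (add_le_add (abs_apply_le_dualNorm hN f hx) (abs_apply_le_dualNorm hN g hx))

theorem dualNorm_coord_zero {e : SchauderBasis ℝ X} {q N : Seminorm ℝ X}
    (hN : IsEquivalentNorm N) (hball : unitBall N = renormingBall q e.basis) :
    dualNorm N (e.coord 0) = 1 := by
  refine le_antisymm (dualNorm_le fun x hx => abs_coord_zero_le_one (q := q) (hball ▸ hx)) ?_
  have := abs_apply_le_dualNorm hN (e.coord 0) (x := e 0)
    (hball ▸ cap_subset_renormingBall _ _ (head_mem_cap q e.basis))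
  simpa [e.ortho] using this

/-- From a functional `g` of the dual ball one may subtract the largest multiple of `e.coord n` for
which the result is still at least `-1` on the cap. It remains in the dual ball, because `e.coord n`
is nonnegative on the cap, and its infimum over the cap is `-1`, while `e.coord 0` is constantly `1`
there. -/
theorem exists_sub_smul_coord {e : SchauderBasis ℝ X} {q N : Seminorm ℝ X}
    (hq1 : ∀ n, q (e n) = 1) (hu : IsOneUnconditional q e.basis)
    (hN : IsEquivalentNorm N) (hball : unitBall N = renormingBall q e.basis)
    {g : StrongDual ℝ X} (hg : dualNorm N g ≤ 1) {n : ℕ} (hn : n ≠ 0) :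
    ∃ t ∈ Set.Icc (0 : ℝ) 1, dualNorm N (g - t • e.coord n) ≤ 1 ∧
      2 ≤ dualNorm N (e.coord 0 - (g - t • e.coord n)) := by
  have hcap : ∀ z ∈ cap q e.basis, z ∈ unitBall N := fun z hz =>
    hball ▸ cap_subset_renormingBall _ _ hz
  have hgz : ∀ z ∈ cap q e.basis, |g z| ≤ 1 := fun z hz =>
    (abs_apply_le_dualNorm hN g (hcap z hz)).trans hg
  have hn0 : e.coord n (e 0) = 0 := by simp [e.ortho, hn]
  have he1 : ∀ k, e.coord k (e k) = 1 := fun k => by simp [e.ortho]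
  have hcoord : ∀ z ∈ cap q e.basis, e.coord n z ∈ Set.Icc (0 : ℝ) 2 ∧ e.coord 0 z = 1 := by
    rintro _ ⟨_, ⟨⟨a, ha0, ha, rfl⟩, hqa⟩, rfl⟩
    have h1 := (coord_le_of_isOneUnconditional hq1 hu a n).trans hqa
    have h2 := ha n
    rw [abs_of_nonneg h2] at h1
    simp only [map_add, map_smul, coord_linearCombination, hn0, he1, ha0, smul_eq_mul]
    exact ⟨⟨by linarith, by linarith⟩, by ring⟩
  set T : Set ℝ := {t | 0 ≤ t ∧ ∀ z ∈ cap q e.basis, -1 ≤ g z - t * e.coord n z} with hT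
  have hT0 : (0 : ℝ) ∈ T := ⟨le_rfl, fun z hz => by simpa using (abs_le.1 (hgz z hz)).1⟩
  -- Evaluation at `e 0 + 2 e n`, whose `n`-th coordinate is `2`.
  have hT1 : ∀ t ∈ T, t ≤ 1 := fun t ht => by
    have hz := head_add_single_mem_cap hq1 hn
    have h1 := ht.2 _ hz
    have h2 := (abs_le.1 (hgz _ hz)).2
    have h3 : e.coord n (e 0 + (2 : ℝ) • e n) = 2 := by
      simp [hn0, he1]
    rw [h3] at h1
    linarith
  have hclosed : IsClosed T := by
    have : T = Set.Ici 0 ∩ ⋂ z ∈ cap q e.basis, {t | -1 ≤ g z - t * e.coord n z} := by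
      ext t
      simp [hT]
    rw [this]
    exact isClosed_Ici.inter (isClosed_biInter fun z _ =>
      isClosed_le continuous_const (by fun_prop))
  have hbdd : BddAbove T := ⟨1, hT1⟩
  have ht := hclosed.csSup_mem ⟨0, hT0⟩ hbdd
  set t := sSup T
  have happ : ∀ z, (g - t • e.coord n) z = g z - t * e.coord n z := fun z => rfl
  refine ⟨t, ⟨ht.1, hT1 t ht⟩, dualNorm_le fun x hx => ?_, le_of_forall_pos_le_add fun δ hδ => ?_⟩
  · refine abs_le_of_mem_renormingBall (fun z hz => ?_) (hball ▸ hx)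
    rw [happ, abs_le]
    have := mul_nonneg ht.1 (hcoord z hz).1.1
    exact ⟨ht.2 z hz, by linarith [(abs_le.1 (hgz z hz)).2]⟩
  · have hnot : t + δ / 2 ∉ T := fun h => by
      have := le_csSup hbdd h
      linarith
    have : ∃ z ∈ cap q e.basis, g z - (t + δ / 2) * e.coord n z < -1 := by
      by_contra! h
      exact hnot ⟨by linarith [ht.1], h⟩
    obtain ⟨z, hz, hlt⟩ := this
    have h1 := (le_abs_self _).trans
      (abs_apply_le_dualNorm hN (e.coord 0 - (g - t • e.coord n)) (hcap z hz))
    rw [sub_apply, happ, (hcoord z hz).2] at h1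
    nlinarith [(hcoord z hz).1.2]

/-- The part of the argument common to the weak-star and to the weak topology: `S` stands for a
relatively open subset of the dual ball, and `hS` says that bounded multiples of `e.coord n` tend to
`0` in the topology at hand. -/
theorem isLUB_dualNorm_coord_zero_sub {e : SchauderBasis ℝ X} {q N : Seminorm ℝ X}
    (hq1 : ∀ n, q (e n) = 1) (hu : IsOneUnconditional q e.basis)
    (hN : IsEquivalentNorm N) (hball : unitBall N = renormingBall q e.basis)
    {S : Set (StrongDual ℝ X)} (hSball : S ⊆ unitBall (dualNorm N)) (hne : S.Nonempty)
    (hS : ∀ g ∈ S, ∀ t : ℕ → ℝ, (∀ n, t n ∈ Set.Icc (0 : ℝ) 1) →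
      (∀ n, dualNorm N (g - t n • e.coord n) ≤ 1) → ∃ n ≠ 0, g - t n • e.coord n ∈ S) :
    IsLUB ((fun g => dualNorm N (e.coord 0 - g)) '' S) 2 := by
  constructor
  · rintro _ ⟨g, hg, rfl⟩
    have h1 : dualNorm N g ≤ 1 := hSball hg
    have h2 := dualNorm_coord_zero hN hball
    exact (dualNorm_sub_le hN _ _).trans (by linarith)
  · intro b hb
    obtain ⟨g, hg⟩ := hne
    have hg1 : dualNorm N g ≤ 1 := hSball hg
    choose! t ht1 ht2 ht3 using
      fun (n : ℕ) (hn : n ≠ 0) => exists_sub_smul_coord hq1 hu hN hball hg1 hn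
    obtain ⟨n, hn, hmem⟩ := hS g hg (fun n => if n = 0 then 0 else t n)
      (fun n => by
        by_cases h : n = 0
        · simp [h]
        · simpa only [if_neg h] using ht1 n h)
      (fun n => by
        by_cases h : n = 0
        · simpa [h] using hg1
        · simpa only [if_neg h] using ht2 n h)
    rw [if_neg hn] at hmem
    exact (ht3 n hn).trans (hb ⟨_, hmem, rfl⟩)

theorem tendsto_coord_zero {e : SchauderBasis ℝ X} (he : IsUnconditional e) {c : ℝ} (hc : 0 < c)
    (hce : ∀ n, c ≤ ‖e n‖) (x : X) : Tendsto (fun n => e.coord n x) atTop (𝓝 0) := by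
  have h1 := ((he x).tendsto_atTop_zero.norm).const_mul c⁻¹
  rw [norm_zero, mul_zero] at h1
  refine squeeze_zero_norm (fun n => ?_) h1
  rw [norm_smul, le_inv_mul_iff₀ hc, mul_comm]
  exact mul_le_mul_of_nonneg_left (hce n) (norm_nonneg _)

theorem isWeakStarSuperDaugavetPoint_coord_zero {e : SchauderBasis ℝ X} {q N : Seminorm ℝ X}
    (he : IsUnconditional e) {c : ℝ} (hc : 0 < c) (hce : ∀ n, c ≤ ‖e n‖)
    (hq1 : ∀ n, q (e n) = 1) (hu : IsOneUnconditional q e.basis)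
    (hN : IsEquivalentNorm N) (hball : unitBall N = renormingBall q e.basis) :
    IsWeakStarSuperDaugavetPoint N (Submodule.span ℝ (Set.range e.coord)).topologicalClosure
      (e.coord 0) := by
  have hmem : ∀ n, e.coord n ∈ (Submodule.span ℝ (Set.range e.coord)).topologicalClosure :=
    fun n => Submodule.le_topologicalClosure _ (Submodule.subset_span ⟨n, rfl⟩)
  refine ⟨hmem 0, dualNorm_coord_zero hN hball, fun V hV hne => ?_⟩
  refine isLUB_dualNorm_coord_zero_sub hq1 hu hN hball (fun g hg => hg.2.2) hne ?_
  rintro g ⟨hgV, hgE, -⟩ t ht htN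
  have hlim : Tendsto (fun n => StrongDual.toWeakDual (g - t n • e.coord n)) atTop
      (𝓝 (StrongDual.toWeakDual g)) := by
    rw [tendsto_iff_forall_eval_tendsto_topDualPairing]
    intro x
    have := (tendsto_mul_of_mem_Icc ht (tendsto_coord_zero he hc hce x)).const_sub (g x)
    rwa [sub_zero] at this
  obtain ⟨n, hnV, hn⟩ := ((hlim.eventually (hV.mem_nhds hgV)).and (eventually_ne_atTop 0)).exists
  exact ⟨n, hn, hnV, Submodule.sub_mem _ hgE (Submodule.smul_mem _ _ (hmem n)), htN n⟩

theorem isSuperDaugavetPoint_coord_zero {e : SchauderBasis ℝ X} {q N : Seminorm ℝ X}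
    (he : IsWeaklyNull e.coord)
    (hq1 : ∀ n, q (e n) = 1) (hu : IsOneUnconditional q e.basis)
    (hN : IsEquivalentNorm N) (hball : unitBall N = renormingBall q e.basis) :
    IsSuperDaugavetPoint (dualNorm N) (e.coord 0) := by
  refine ⟨dualNorm_coord_zero hN hball, fun V hV hne => ?_⟩
  refine isLUB_dualNorm_coord_zero_sub hq1 hu hN hball (fun g hg => hg.2) hne ?_
  rintro g ⟨hgV, -⟩ t ht htN
  have hneg : IsWeaklyNull fun n => -e.coord n := by
    rw [isWeaklyNull_iff] at he ⊢
    intro Φ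
    simpa using (he Φ).neg
  have hlim := hneg.tendsto_add_smul ht g
  simp only [smul_neg, ← sub_eq_add_neg] at hlim
  obtain ⟨n, hnV, hn⟩ := ((hlim.eventually (hV.mem_nhds hgV)).and (eventually_ne_atTop 0)).exists
  exact ⟨n, hn, hnV, htN n⟩

/-! ### A normalizing 1-unconditional renorming -/

/-- If all finite subsums of `u` are bounded by `M`, then finite sums with multipliers bounded by
`r` are bounded by `2 r M`: for a functional of norm at most one, the absolute values of its values on
the terms add up to the difference of its values on two subsums. -/
theorem norm_sum_smul_le {ι : Type*} {u : ι → X} {M : ℝ}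
    (hM : ∀ F : Finset ι, ‖∑ n ∈ F, u n‖ ≤ M) {s : ι → ℝ} {r : ℝ} (hr : 0 ≤ r)
    (hs : ∀ n, |s n| ≤ r) (F : Finset ι) : ‖∑ n ∈ F, s n • u n‖ ≤ r * (2 * M) := by
  classical
  obtain ⟨f, hf, hfx⟩ := exists_dual_vector'' ℝ (∑ n ∈ F, s n • u n)
  have hfM : ∀ G : Finset ι, |∑ n ∈ G, f (u n)| ≤ M := fun G => by
    rw [← map_sum]
    refine (f.le_opNorm _).trans ?_
    exact (mul_le_of_le_one_left (norm_nonneg _) hf).trans (hM G)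
  have habs : ∑ n ∈ F, |f (u n)| ≤ 2 * M := by
    rw [← Finset.sum_filter_add_sum_filter_not F (fun n => 0 ≤ f (u n))]
    have h1 : ∑ n ∈ F with 0 ≤ f (u n), |f (u n)| ≤ M := by
      rw [Finset.sum_congr rfl fun n hn => abs_of_nonneg (Finset.mem_filter.1 hn).2]
      exact (le_abs_self _).trans (hfM _)
    have h2 : ∑ n ∈ F with ¬ 0 ≤ f (u n), |f (u n)| ≤ M := by
      rw [Finset.sum_congr rfl fun n hn => abs_of_neg (not_le.1 (Finset.mem_filter.1 hn).2),
        Finset.sum_neg_distrib]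
      exact (neg_le_abs _).trans (hfM _)
    linarith
  have : ‖∑ n ∈ F, s n • u n‖ = ∑ n ∈ F, s n * f (u n) := by
    have : f (∑ n ∈ F, s n • u n) = ‖∑ n ∈ F, s n • u n‖ := hfx
    rw [← this, map_sum]
    simp
  rw [this]
  calc ∑ n ∈ F, s n * f (u n) ≤ ∑ n ∈ F, r * |f (u n)| := Finset.sum_le_sum fun n _ => by
        refine (le_abs_self _).trans ?_
        rw [abs_mul]
        exact mul_le_mul_of_nonneg_right (hs n) (abs_nonneg _)
    _ = r * ∑ n ∈ F, |f (u n)| := by rw [Finset.mul_sum]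
    _ ≤ r * (2 * M) := mul_le_mul_of_nonneg_left habs hr

theorem IsWeaklyNull.exists_norm_le {u : ℕ → X} (hu : IsWeaklyNull u) :
    ∃ M, ∀ n, ‖u n‖ ≤ M := by
  rw [isWeaklyNull_iff] at hu
  obtain ⟨M, hM⟩ := banach_steinhaus (g := fun n => NormedSpace.inclusionInDoubleDual ℝ X (u n))
    fun f => by
      obtain ⟨C, hC⟩ := isBounded_iff_forall_norm_le.1
        (Metric.isBounded_range_of_tendsto _ (hu f))
      exact ⟨C, fun n => hC _ ⟨n, rfl⟩⟩
  refine ⟨M, fun n => ?_⟩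
  rw [← (NormedSpace.inclusionInDoubleDualLi ℝ).norm_map]
  exact hM n

theorem IsUnconditional.exists_norm_sum_le [CompleteSpace X] {e : SchauderBasis ℝ X}
    (he : IsUnconditional e) :
    ∃ C, ∀ (F : Finset ℕ) (x : X), ‖∑ n ∈ F, e.coord n x • e n‖ ≤ C * ‖x‖ := by
  let b : UnconditionalSchauderBasis ℕ ℝ X :=
    { basis := e.basis
      coord := e.coord
      ortho := e.ortho
      expansion := fun x => by
        obtain ⟨y, hy⟩ := he x
        have hy' := hy.mono_left (SummationFilter.conditional ℕ).le_atTop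
        exact (tendsto_nhds_unique hy' (e.expansion x)) ▸ hy }
  obtain ⟨C, hC⟩ := b.exists_norm_proj_le
  refine ⟨C, fun F x => ?_⟩
  have := (b.proj F).le_of_opNorm_le (hC F) x
  rwa [GeneralSchauderBasis.proj_apply] at this

/-- The coordinatewise multiplication by `s` on the finite set `F`, and by `0` off it. -/
noncomputable def multiplier (e : SchauderBasis ℝ X) (F : Finset ℕ) (s : ℕ → ℝ) : X →L[ℝ] X :=
  ∑ n ∈ F, s n • (e.coord n).smulRight (e n)

theorem multiplier_apply (e : SchauderBasis ℝ X) (F : Finset ℕ) (s : ℕ → ℝ) (x : X) :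
    multiplier e F s x = ∑ n ∈ F, s n • e.coord n x • e n := by
  simp [multiplier]

/-- The supremum of the norms of all finite multiples `∑ n ∈ F, s n * x n • e n` of `x` with
`|s n| ≤ 1 / ‖e n‖`. These weights make the norm 1-unconditional and normalize the basis at the same
time. -/
noncomputable def multiplierNorm (e : SchauderBasis ℝ X) : Seminorm ℝ X :=
  ⨆ i : Finset ℕ × {s : ℕ → ℝ // ∀ n, |s n| * ‖e n‖ ≤ 1},
    (normSeminorm ℝ X).comp (multiplier e i.1 i.2.1).toLinearMap

theorem exists_norm_multiplier_le [CompleteSpace X] {e : SchauderBasis ℝ X}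
    (he : IsUnconditional e) {c : ℝ} (hc : 0 < c) (hce : ∀ n, c ≤ ‖e n‖) :
    ∃ C, ∀ (F : Finset ℕ) (s : ℕ → ℝ), (∀ n, |s n| * ‖e n‖ ≤ 1) → ∀ x,
      ‖multiplier e F s x‖ ≤ C * ‖x‖ := by
  obtain ⟨C, hC⟩ := he.exists_norm_sum_le
  refine ⟨c⁻¹ * (2 * C), fun F s hs x => ?_⟩
  rw [multiplier_apply, mul_assoc, mul_assoc]
  refine norm_sum_smul_le (fun G => hC G x) (inv_nonneg.2 hc.le) (fun n => ?_) F
  rw [← one_div, le_div_iff₀ hc]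
  exact (mul_le_mul_of_nonneg_left (hce n) (abs_nonneg _)).trans (hs n)

theorem multiplierNorm_isLUB [CompleteSpace X] {e : SchauderBasis ℝ X}
    (he : IsUnconditional e) {c : ℝ} (hc : 0 < c) (hce : ∀ n, c ≤ ‖e n‖) (x : X) :
    IsLUB {r | ∃ (F : Finset ℕ) (s : ℕ → ℝ), (∀ n, |s n| * ‖e n‖ ≤ 1) ∧
      r = ‖multiplier e F s x‖} (multiplierNorm e x) := by
  obtain ⟨C, hC⟩ := exists_norm_multiplier_le he hc hce
  have hbdd : BddAbove (Set.range fun i : Finset ℕ × {s : ℕ → ℝ // ∀ n, |s n| * ‖e n‖ ≤ 1} =>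
      (normSeminorm ℝ X).comp (multiplier e i.1 i.2.1).toLinearMap) := by
    rw [Seminorm.bddAbove_range_iff]
    intro y
    refine ⟨C * ‖y‖, ?_⟩
    rintro _ ⟨i, rfl⟩
    exact hC i.1 i.2.1 i.2.2 y
  have : Nonempty {s : ℕ → ℝ // ∀ n, |s n| * ‖e n‖ ≤ 1} := ⟨0, by simp⟩
  rw [multiplierNorm, Seminorm.iSup_apply hbdd]
  have hset : {r | ∃ (F : Finset ℕ) (s : ℕ → ℝ), (∀ n, |s n| * ‖e n‖ ≤ 1) ∧
      r = ‖multiplier e F s x‖} =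
      Set.range fun i : Finset ℕ × {s : ℕ → ℝ // ∀ n, |s n| * ‖e n‖ ≤ 1} =>
        (normSeminorm ℝ X).comp (multiplier e i.1 i.2.1).toLinearMap x := by
    ext r
    constructor
    · rintro ⟨F, s, hs, rfl⟩
      exact ⟨(F, ⟨s, hs⟩), rfl⟩
    · rintro ⟨⟨F, s, hs⟩, rfl⟩
      exact ⟨F, s, hs, rfl⟩
  rw [hset]
  refine isLUB_ciSup ⟨C * ‖x‖, ?_⟩
  rintro _ ⟨i, rfl⟩
  exact hC i.1 i.2.1 i.2.2 x

theorem exists_isOneUnconditional_norm [CompleteSpace X] {e : SchauderBasis ℝ X}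
    (he : IsUnconditional e) {c : ℝ} (hc : 0 < c) (hce : ∀ n, c ≤ ‖e n‖) {M : ℝ}
    (hM : ∀ n, ‖e n‖ ≤ M) :
    ∃ q : Seminorm ℝ X, IsEquivalentNorm q ∧ (∀ n, q (e n) = 1) ∧
      IsOneUnconditional q e.basis := by
  have hlub := multiplierNorm_isLUB he hc hce
  have hM0 : 0 < M := hc.trans_le ((hce 0).trans (hM 0))
  have hpos : ∀ n, 0 < ‖e n‖ := fun n => hc.trans_le (hce n)
  refine ⟨multiplierNorm e, ?_, fun n => ?_, fun a b hab => ?_⟩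
  · obtain ⟨C, hC⟩ := exists_norm_multiplier_le he hc hce
    refine ⟨M⁻¹, C, by positivity, fun x => ⟨?_, ?_⟩⟩
    · refine le_of_tendsto ((SchauderBasis.tendsto_proj e x).norm.const_mul M⁻¹)
        (Eventually.of_forall fun m => ?_)
      refine (hlub x).1 ⟨Finset.range m, fun _ => M⁻¹, fun n => ?_, ?_⟩
      · rw [abs_of_pos (by positivity), inv_mul_le_iff₀ hM0, mul_one]
        exact hM n
      · rw [multiplier_apply, ← Finset.smul_sum, norm_smul, Real.norm_of_nonneg (by positivity),
          SchauderBasis.proj_apply]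
    · refine (hlub x).2 ?_
      rintro _ ⟨F, s, hs, rfl⟩
      exact hC F s hs x
  · have happ : ∀ F s, multiplier e F s (e n) = if n ∈ F then s n • e n else 0 := fun F s => by
      simp [multiplier_apply, e.ortho, Pi.single_apply]
    refine le_antisymm ((hlub _).2 ?_) ((hlub _).1 ⟨{n}, fun k => ‖e k‖⁻¹, fun k => ?_, ?_⟩)
    · rintro _ ⟨F, s, hs, rfl⟩
      rw [happ]
      split_ifs
      · rw [norm_smul]; exact hs n
      · simp
    · rw [abs_of_nonneg (by positivity), inv_mul_cancel₀ (hpos k).ne']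
    · rw [happ, if_pos (Finset.mem_singleton_self n), norm_smul,
        Real.norm_of_nonneg (by positivity), inv_mul_cancel₀ (hpos n).ne']
  · refine (hlub _).2 ?_
    rintro _ ⟨F, s, hs, rfl⟩
    refine (hlub _).1 ⟨F, fun n => s n * (a n / b n), fun n => ?_, ?_⟩
    · have : |a n / b n| ≤ 1 := by
        rw [abs_div]
        exact div_le_one_of_le₀ (hab n) (abs_nonneg _)
      rw [abs_mul]
      refine le_trans ?_ (hs n)
      exact mul_le_mul_of_nonneg_right (mul_le_of_le_one_right (abs_nonneg _) this)
        (norm_nonneg _)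
    · simp only [multiplier_apply, coord_linearCombination, smul_smul]
      congr 1
      refine Finset.sum_congr rfl fun n _ => ?_
      rcases eq_or_ne (b n) 0 with h | h
      · -- Here `a n / b n` is a junk value, but `a n` vanishes as well.
        have : a n = 0 := by
          have := hab n
          rw [h, abs_zero] at this
          exact abs_nonpos_iff.1 this
        simp [h, this]
      · rw [mul_assoc, div_mul_cancel₀ _ h]

/-! ### The unit vector basis of `ℓ²` -/

theorem inner_unitVector (n : ℕ) (x : lp (fun _ : ℕ => ℝ) 2) :
    innerSL ℝ (unitVector n) x = x n := by
  classical
  rw [innerSL_apply_apply, unitVector]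
  have := lp.inner_single_left (𝕜 := ℝ) n (1 : ℝ) x
  simpa using this

theorem hasSum_unitVector (x : lp (fun _ : ℕ => ℝ) 2) :
    HasSum (fun n => innerSL ℝ (unitVector n) x • unitVector n) x := by
  have := lp.hasSum_single (p := 2) (by norm_num) x
  convert this using 2 with n
  rw [inner_unitVector, unitVector, ← lp.single_smul, smul_eq_mul, mul_one]

/-- The unit vectors of `ℓ²`, as a Schauder basis. -/
noncomputable def unitVectorBasis : SchauderBasis ℝ (lp (fun _ : ℕ => ℝ) 2) where
  basis := unitVector
  coord n := innerSL ℝ (unitVector n)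
  ortho i j := by
    rw [inner_unitVector, unitVector]
    simp [Pi.single_apply]
  expansion x := (hasSum_unitVector x).mono_left (SummationFilter.conditional ℕ).le_atTop

theorem isUnconditional_unitVectorBasis : IsUnconditional unitVectorBasis :=
  fun x => (hasSum_unitVector x).summable

theorem norm_unitVector (n : ℕ) : ‖unitVector n‖ = 1 := by
  simp [unitVector, lp.norm_single]

theorem isWeaklyNull_unitVector : IsWeaklyNull unitVector := by
  rw [isWeaklyNull_iff]
  intro f
  have := tendsto_coord_zero isUnconditional_unitVectorBasis one_pos
    (fun n => (norm_unitVector n).ge) ((InnerProductSpace.toDual ℝ _).symm f)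
  refine this.congr fun n => ?_
  change inner ℝ (unitVector n) _ = _
  rw [real_inner_comm, InnerProductSpace.toDual_symm_apply]

theorem isWeaklyNull_innerSL_unitVector :
    IsWeaklyNull fun n => innerSL ℝ (unitVector n) := by
  rw [isWeaklyNull_iff]
  intro Φ
  exact isWeaklyNull_iff.1 isWeaklyNull_unitVector (Φ.comp
    (isBoundedBilinearMap_inner (𝕜 := ℝ) (E := lp (fun _ : ℕ => ℝ) 2)).toContinuousLinearMap)

theorem isOneUnconditional_unitVector :
    IsOneUnconditional (fun x : lp (fun _ : ℕ => ℝ) 2 => ‖x‖) unitVector := by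
  intro a b hab
  refine lp.norm_mono two_ne_zero fun n => ?_
  rw [← inner_unitVector, ← inner_unitVector]
  have h := coord_linearCombination unitVectorBasis
  change ‖unitVectorBasis.coord n (linearCombination ℝ unitVectorBasis.basis a)‖ ≤
    ‖unitVectorBasis.coord n (linearCombination ℝ unitVectorBasis.basis b)‖
  rw [h, h]
  exact hab n

theorem isEquivalentNorm_normSeminorm : IsEquivalentNorm (normSeminorm ℝ X) :=
  ⟨1, 1, one_pos, fun x => by simp⟩

end SuperDaugavet

theorem theorem4p2 :
    (∀ (X : Type*) [NormedAddCommGroup X] [NormedSpace ℝ X] [CompleteSpace X]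
        (e : SchauderBasis ℝ X),
      SuperDaugavet.IsUnconditional e →
      SuperDaugavet.IsWeaklyNull e.basis →
      (∃ c : ℝ, 0 < c ∧ ∀ n, c ≤ ‖e n‖) →
      (∃ q : Seminorm ℝ X, SuperDaugavet.IsEquivalentNorm q ∧ (∀ n, q (e n) = 1) ∧
        SuperDaugavet.IsOneUnconditional q e.basis) ∧
      ∀ q : Seminorm ℝ X, SuperDaugavet.IsEquivalentNorm q → (∀ n, q (e n) = 1) →
        SuperDaugavet.IsOneUnconditional q e.basis →
        ∃ N : Seminorm ℝ X, SuperDaugavet.IsEquivalentNorm N ∧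
          SuperDaugavet.unitBall N = SuperDaugavet.renormingBall q e.basis ∧
          SuperDaugavet.IsSuperDaugavetPoint N (e 0) ∧
          SuperDaugavet.IsWeakStarSuperDaugavetPoint N
            (Submodule.span ℝ (Set.range e.coord)).topologicalClosure (e.coord 0)) ∧
    ∃ N : Seminorm ℝ (lp (fun _ : ℕ => ℝ) 2), SuperDaugavet.IsEquivalentNorm N ∧
      SuperDaugavet.unitBall N =
        SuperDaugavet.renormingBall (fun x => ‖x‖) SuperDaugavet.unitVector ∧
      SuperDaugavet.IsSuperDaugavetPoint N (SuperDaugavet.unitVector 0) ∧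
      SuperDaugavet.IsSuperDaugavetPoint (SuperDaugavet.dualNorm N)
        (innerSL ℝ (SuperDaugavet.unitVector 0)) := by
  open SuperDaugavet in
  refine ⟨fun X _ _ _ e he hnull ⟨c, hc, hce⟩ => ⟨?_, fun q hq hq1 hu => ?_⟩, ?_⟩
  · obtain ⟨M, hM⟩ := hnull.exists_norm_le
    exact exists_isOneUnconditional_norm he hc hce hM
  · obtain ⟨N, hN, hball⟩ := exists_norm_unitBall_eq_renormingBall hq hq1 hu
    exact ⟨N, hN, hball, isSuperDaugavetPoint_head hnull hq hq1 hu hN hball,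
      isWeakStarSuperDaugavetPoint_coord_zero he hc hce hq1 hu hN hball⟩
  · have hq1 : ∀ n, normSeminorm ℝ (lp (fun _ : ℕ => ℝ) 2) (unitVectorBasis n) = 1 :=
      norm_unitVector
    obtain ⟨N, hN, hball⟩ := exists_norm_unitBall_eq_renormingBall (e := unitVectorBasis)
      isEquivalentNorm_normSeminorm hq1 isOneUnconditional_unitVector
    exact ⟨N, hN, hball,
      isSuperDaugavetPoint_head (e := unitVectorBasis) isWeaklyNull_unitVector
        isEquivalentNorm_normSeminorm hq1 isOneUnconditional_unitVector hN hball,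
      isSuperDaugavetPoint_coord_zero (e := unitVectorBasis) isWeaklyNull_innerSL_unitVector
        hq1 isOneUnconditional_unitVector hN hball⟩
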